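/- Let $\Gamma$ be a finite connected simple graph whose edges are numbered by a linear order, and let $v$ be a vertex of $\Gamma$ (the special, or base, vertex). A reduced enhanced state $S$ is a spanning subgraph of $\Gamma$ (all vertices and a subset of the edges) together with a coloring of its connected components by the two colors $1$ and $x$ such that the component containing $v$ has color $x$. Its dimension is the number of its edges, and its degree is the number of components colored $x$, minus $1$. Let $\widetilde C^{i,j}(\Gamma,v)$ be the real vector space with basis the reduced enhanced states of dimension $i$ and degree $j$, and let $d:\widetilde C^{i,j}(\Gamma,v)\to\widetilde C^{i+1,j}(\Gamma,v)$ be the linear map with $$d(S)=\sum_{e\notin S}(-1)^{\#\{f\in S\,:\,f<e\}}\,(S\cup e),$$ where $S\cup e$ is obtained by adding the edge $e$; all components not changed as vertex sets keep their colors, and if $e$ joins two different components of $S$, then the new component is colored by the product of their colors according to $1\times 1=1$, $1\times x=x\times 1=x$, $x\times x=0$ (in the last case the term is $0$). The reduced chromatic cohomology groups are $$\widetilde H^{i,j}(\Gamma,v)=\frac{\ker\bigl(d:\widetilde C^{i,j}(\Gamma,v)\to\widetilde C^{i+1,j}(\Gamma,v)\bigr)}{\operatorname{im}\bigl(d:\widetilde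 C^{i-1,j}(\Gamma,v)\to\widetilde C^{i,j}(\Gamma,v)\bigr)}.$$ Then, up to isomorphism, these groups do not depend on the choice of the special vertex: for any two vertices $v,v'$ of $\Gamma$ and all integers $i,j$ there is an isomorphism of real vector spaces $$\widetilde H^{i,j}(\Gamma,v)\cong\widetilde H^{i,j}(\Gamma,v').$$ -/

import Mathlib

/-! Reduced chromatic cohomology of a finite graph with a base vertex.

A graph is given by a vertex type `V`, an edge type `E` and the map `ends : E → Sym2 V` sending an
edge to its pair of end points (so loops and multiple edges are allowed in the definitions).
The edges are numbered by a linear order on `E`. -/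

namespace ChromaticCohomology

/-- The two colors `1` and `x`. -/
inductive Color
  | one
  | x

/-- The spanning subgraph with edge set `s`, recorded as a simple graph on `V`. Loops and
multiplicities of edges are forgotten, which does not affect connected components. -/
def stateGraph {V E : Type*} (ends : E → Sym2 V) (s : Finset E) : SimpleGraph V :=
  SimpleGraph.fromEdgeSet (ends '' (s : Set E))

/-- A reduced enhanced state: a spanning subgraph (given by its set of edges) together with a
coloring of its connected components, such that the component of the base vertex `v` has
color `x`. -/
structure EnhancedState {V E : Type*} (ends : E → Sym2 V) (v : V) where
  edges : Finset E
  color : (stateGraph ends edges).ConnectedComponent → Color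
  base_color : color ((stateGraph ends edges).connectedComponentMk v) = Color.x

namespace EnhancedState

variable {V E : Type*} {ends : E → Sym2 V} {v : V}

/-- The connected component of the vertex `u` in the underlying state. -/
def comp (S : EnhancedState ends v) (u : V) : (stateGraph ends S.edges).ConnectedComponent :=
  (stateGraph ends S.edges).connectedComponentMk u

/-- The color of the connected component of the vertex `u`. -/
def colorAt (S : EnhancedState ends v) (u : V) : Color :=
  S.color (S.comp u)

/-- The dimension: the number of edges. -/
def dimension (S : EnhancedState ends v) : ℤ :=
  (S.edges.card : ℤ)

/-- The degree: the number of connected components colored `x`, minus one. -/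
noncomputable def degree (S : EnhancedState ends v) : ℤ :=
  (({K | S.color K = Color.x} : Set (stateGraph ends S.edges).ConnectedComponent).ncard : ℤ) - 1

/-- Adding `e` to `S` meets the case `x × x = 0` of the multiplication rule: `e` joins two different
connected components of `S`, both colored `x`. -/
def Annihilates (S : EnhancedState ends v) (e : E) : Prop :=
  ∃ a b : V, ends e = s(a, b) ∧ S.comp a ≠ S.comp b ∧
    S.colorAt a = Color.x ∧ S.colorAt b = Color.x

open Classical in
/-- The state `S ∪ e`. A component `K` of the new state is the union of one or two components of
`S`; it is colored `x` if one of these is colored `x`, and `1` otherwise. Thus a component that is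
not changed as a vertex set keeps its color, and a component made by joining two components is
colored according to `1 × 1 = 1`, `1 × x = x`, `x × 1 = x`. (In the remaining case `x × x = 0`,
which is `Annihilates`, the enhanced state `S.addEdge e` does not enter the differential.) -/
noncomputable def addEdge (S : EnhancedState ends v) (e : E) : EnhancedState ends v where
  edges := insert e S.edges
  color K := if ∃ u : V, (stateGraph ends (insert e S.edges)).connectedComponentMk u = K ∧
    S.colorAt u = Color.x then Color.x else Color.one
  base_color := if_pos ⟨v, rfl, S.base_color⟩

end EnhancedState

/-- The vector space with basis the reduced enhanced states is an additive group (a shortcut that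
instance search needs for quotients of its submodules). -/
noncomputable instance {V E : Type*} (ends : E → Sym2 V) (v : V) : AddCommGroup (EnhancedState ends v →₀ ℝ) :=
  Finsupp.instAddCommGroup

variable {V E : Type*} [Fintype E] [LinearOrder E]

open Classical in
/-- The differential on the real vector space with basis the reduced enhanced states: a sum over
all edges `e` outside of `S`, with sign `(-1) ^ #{f ∈ S | f < e}`. -/
noncomputable def differential (ends : E → Sym2 V) (v : V) :
    (EnhancedState ends v →₀ ℝ) →ₗ[ℝ] (EnhancedState ends v →₀ ℝ) :=
  Finsupp.linearCombination ℝ fun S : EnhancedState ends v =>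
    ∑ e : E with e ∉ S.edges,
      if S.Annihilates e then 0
      else Finsupp.single (S.addEdge e) ((-1 : ℝ) ^ (S.edges.filter (· < e)).card)

/-- The cochain group of bidegree `(i, j)`: the span of the reduced enhanced states of dimension `i`
and degree `j`. -/
def cochains {V E : Type*} (ends : E → Sym2 V) (v : V) (i j : ℤ) :
    Submodule ℝ (EnhancedState ends v →₀ ℝ) :=
  Finsupp.supported ℝ ℝ {S : EnhancedState ends v | S.dimension = i ∧ S.degree = j}

/-- The kernel of the differential on cochains of bidegree `(i, j)`. -/
noncomputable def cocycles (ends : E → Sym2 V) (v : V) (i j : ℤ) :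
    Submodule ℝ (EnhancedState ends v →₀ ℝ) :=
  cochains ends v i j ⊓ LinearMap.ker (differential ends v)

/-- The image under the differential of the cochains of bidegree `(i - 1, j)`. -/
noncomputable def coboundaries (ends : E → Sym2 V) (v : V) (i j : ℤ) :
    Submodule ℝ (EnhancedState ends v →₀ ℝ) :=
  (cochains ends v (i - 1) j).map (differential ends v)

/-- The reduced chromatic cohomology of bidegree `(i, j)`: cocycles modulo coboundaries. -/
abbrev reducedCohomology (ends : E → Sym2 V) (v : V) (i j : ℤ) : Type _ :=
  ↥(cocycles ends v i j) ⧸ (coboundaries ends v i j).submoduleOf (cocycles ends v i j)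

end ChromaticCohomology

/-- The reduced chromatic cohomology of the simple graph `G` with base vertex `v`, whose edges
are numbered by a linear order. -/
abbrev SimpleGraph.reducedCohomology {V : Type*} (G : SimpleGraph V) [Fintype G.edgeSet]
    [LinearOrder G.edgeSet] (v : V) (i j : ℤ) : Type _ :=
  ChromaticCohomology.reducedCohomology (fun e : G.edgeSet => (e : Sym2 V)) v i j

/-! For a connected graph the reduced cohomology lives on the single diagonal `i + j = |V| - 1`. For
fixed `j` the complex is thus exact except in one degree, and there the dimension of the cohomology
is forced by the dimensions of the cochain groups (`eq_of_exact_away`). These do not depend on the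
base vertex: exchanging the colors of the two base components is a bijection of states preserving
both gradings (`finrank_cochains`). No comparison of differentials for `v` and `v'` is needed.

Concentration (`exactAt_of_preconnected`) is proved by induction on the free edges `F` for the
complex of states between `s` and `s ∪ F`; enlarging `s` plays the role of contraction. Choose `e`
in `F` with an end in the base component of `s`. That component is colored `x`, so adding `e` is
surjective onto cochains containing `e`, with section `liftOp`, and every class is represented by
states which `e` annihilates (`exactAt_of_cocycles`). If `e` is a loop after contracting `s`, there
are none. If `e` is a bridge of `s ∪ F`, they form the contracted complex shifted by `(1, -1)`, on
the same diagonal. Otherwise deletion keeps connectedness and the deletion-contraction argument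
applies. -/

namespace ChromaticCohomology

/-! ### Connected components when an edge is added -/

section Reachability

variable {V E : Type*} {ends : E → Sym2 V}

theorem reachable_of_mem {s : Finset E} {e : E} {a b : V} (he : e ∈ s) (hab : ends e = s(a, b)) :
    (stateGraph ends s).Reachable a b := by
  by_cases h : a = b
  · exact h ▸ SimpleGraph.Reachable.refl _
  · refine SimpleGraph.Adj.reachable ?_
    rw [stateGraph, SimpleGraph.fromEdgeSet_adj]
    exact ⟨⟨e, he, hab⟩, h⟩

theorem reachable_mono {s t : Finset E} (h : s ⊆ t) {a b : V}
    (hab : (stateGraph ends s).Reachable a b) : (stateGraph ends t).Reachable a b :=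
  hab.mono (SimpleGraph.fromEdgeSet_mono (Set.image_mono (by exact_mod_cast h)))

/-- Reachability is the smallest equivalence relation containing the edges. -/
theorem rel_of_reachable {s : Finset E} {r : V → V → Prop} (hr : Equivalence r)
    (h : ∀ e ∈ s, ∀ a b, ends e = s(a, b) → r a b) {a b : V}
    (hab : (stateGraph ends s).Reachable a b) : r a b := by
  obtain ⟨w⟩ := hab
  induction w with
  | nil => exact hr.refl _
  | cons hadj _ ih =>
    rw [stateGraph, SimpleGraph.fromEdgeSet_adj] at hadj
    obtain ⟨⟨e, he, hab⟩, -⟩ := hadj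
    exact hr.trans (h e he _ _ hab) ih

/-- The map on connected components induced by an inclusion of edge sets. -/
def componentMap {s t : Finset E} (h : s ⊆ t) :
    (stateGraph ends s).ConnectedComponent → (stateGraph ends t).ConnectedComponent :=
  Quot.map id fun _ _ hab => reachable_mono h hab

@[simp] theorem componentMap_mk {s t : Finset E} (h : s ⊆ t) (u : V) :
    componentMap (ends := ends) h ((stateGraph ends s).connectedComponentMk u) =
      (stateGraph ends t).connectedComponentMk u := rfl

theorem componentMap_surjective {s t : Finset E} (h : s ⊆ t) :
    Function.Surjective (componentMap (ends := ends) h) := by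
  intro K
  induction K using SimpleGraph.ConnectedComponent.ind with
  | h u => exact ⟨_, componentMap_mk h u⟩

variable [DecidableEq E]

theorem reachable_insert_iff {s : Finset E} {e : E} {a b : V} (hab : ends e = s(a, b)) {x y : V} :
    (stateGraph ends (insert e s)).Reachable x y ↔ (stateGraph ends s).Reachable x y ∨
      ((stateGraph ends s).Reachable x a ∧ (stateGraph ends s).Reachable b y) ∨
      ((stateGraph ends s).Reachable x b ∧ (stateGraph ends s).Reachable a y) := by
  constructor
  · refine rel_of_reachable (r := fun x y => (stateGraph ends s).Reachable x y ∨
      ((stateGraph ends s).Reachable x a ∧ (stateGraph ends s).Reachable b y) ∨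
      ((stateGraph ends s).Reachable x b ∧ (stateGraph ends s).Reachable a y)) ⟨?_, ?_, ?_⟩ ?_
    · exact fun x => Or.inl (SimpleGraph.Reachable.refl _)
    · rintro x y (h | ⟨h1, h2⟩ | ⟨h1, h2⟩)
      · exact Or.inl h.symm
      · exact Or.inr (Or.inr ⟨h2.symm, h1.symm⟩)
      · exact Or.inr (Or.inl ⟨h2.symm, h1.symm⟩)
    · rintro x y z (h | ⟨h1, h2⟩ | ⟨h1, h2⟩) (h' | ⟨h3, h4⟩ | ⟨h3, h4⟩)
      · exact Or.inl (h.trans h')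
      · exact Or.inr (Or.inl ⟨h.trans h3, h4⟩)
      · exact Or.inr (Or.inr ⟨h.trans h3, h4⟩)
      · exact Or.inr (Or.inl ⟨h1, h2.trans h'⟩)
      · exact Or.inr (Or.inl ⟨h1, h4⟩)
      · exact Or.inl (h1.trans h4)
      · exact Or.inr (Or.inr ⟨h1, h2.trans h'⟩)
      · exact Or.inl (h1.trans h4)
      · exact Or.inr (Or.inr ⟨h1, h4⟩)
    · intro f hf x y hxy
      rcases Finset.mem_insert.1 hf with rfl | hf
      · rw [hab, Sym2.eq_iff] at hxy
        rcases hxy with ⟨rfl, rfl⟩ | ⟨rfl, rfl⟩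
        · exact Or.inr (Or.inl ⟨SimpleGraph.Reachable.refl _, SimpleGraph.Reachable.refl _⟩)
        · exact Or.inr (Or.inr ⟨SimpleGraph.Reachable.refl _, SimpleGraph.Reachable.refl _⟩)
      · exact Or.inl (reachable_of_mem hf hxy)
  · have hs : s ⊆ insert e s := Finset.subset_insert _ _
    have he := reachable_of_mem (Finset.mem_insert_self e s) hab
    rintro (h | ⟨h1, h2⟩ | ⟨h1, h2⟩)
    · exact reachable_mono hs h
    · exact (reachable_mono hs h1).trans (he.trans (reachable_mono hs h2))
    · exact (reachable_mono hs h1).trans (he.symm.trans (reachable_mono hs h2))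

/-- Adding `e` identifies at most the components of its two ends, so injectivity can fail only if
both are distinct members of `X`. -/
theorem componentMap_injOn {s : Finset E} {e : E} {a b : V} (hab : ends e = s(a, b))
    {X : Set (stateGraph ends s).ConnectedComponent}
    (hX : (stateGraph ends s).connectedComponentMk a ∈ X →
      (stateGraph ends s).connectedComponentMk b ∈ X → (stateGraph ends s).Reachable a b) :
    Set.InjOn (componentMap (ends := ends) (Finset.subset_insert e s)) X := by
  intro K hK K' hK' h
  induction K using SimpleGraph.ConnectedComponent.ind with | h x => ?_
  induction K' using SimpleGraph.ConnectedComponent.ind with | h y => ?_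
  rw [componentMap_mk, componentMap_mk, SimpleGraph.ConnectedComponent.eq,
    reachable_insert_iff hab] at h
  rw [SimpleGraph.ConnectedComponent.eq]
  rcases h with h | ⟨h1, h2⟩ | ⟨h1, h2⟩
  · exact h
  · rw [SimpleGraph.ConnectedComponent.eq.2 h1] at hK
    rw [← SimpleGraph.ConnectedComponent.eq.2 h2] at hK'
    exact h1.trans ((hX hK hK').trans h2)
  · rw [SimpleGraph.ConnectedComponent.eq.2 h1] at hK
    rw [← SimpleGraph.ConnectedComponent.eq.2 h2] at hK'
    exact h1.trans ((hX hK' hK).symm.trans h2)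

/-- Merging two components that both lie in `X` lowers the number of components by one. -/
theorem ncard_image_componentMap [Finite V] {s : Finset E} {e : E} {a b : V}
    (hab : ends e = s(a, b)) {X : Set (stateGraph ends s).ConnectedComponent}
    (ha : (stateGraph ends s).connectedComponentMk a ∈ X)
    (hb : (stateGraph ends s).connectedComponentMk b ∈ X)
    (hn : ¬ (stateGraph ends s).Reachable a b) :
    (componentMap (ends := ends) (Finset.subset_insert e s) '' X).ncard + 1 = X.ncard := by
  set B := (stateGraph ends s).connectedComponentMk b with hB
  have hinj : Set.InjOn (componentMap (ends := ends) (Finset.subset_insert e s)) (X \ {B}) :=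
    componentMap_injOn hab fun _ h => absurd rfl h.2
  have himg : componentMap (ends := ends) (Finset.subset_insert e s) '' X =
      componentMap (Finset.subset_insert e s) '' (X \ {B}) := by
    refine subset_antisymm ?_ (Set.image_mono Set.sdiff_subset)
    rintro _ ⟨K, hK, rfl⟩
    by_cases h : K = B
    · refine ⟨_, ⟨ha, fun h' => hn (SimpleGraph.ConnectedComponent.eq.1 h')⟩, ?_⟩
      rw [h, hB, componentMap_mk, componentMap_mk, SimpleGraph.ConnectedComponent.eq]
      exact reachable_of_mem (Finset.mem_insert_self e s) hab
    · exact ⟨K, ⟨hK, h⟩, rfl⟩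
  rw [himg, hinj.ncard_image, Set.ncard_sdiff_singleton_add_one hb]

theorem card_component_insert [Finite V] {s : Finset E} {e : E} {a b : V}
    (hab : ends e = s(a, b)) (hn : ¬ (stateGraph ends s).Reachable a b) :
    Nat.card (stateGraph ends (insert e s)).ConnectedComponent + 1 =
      Nat.card (stateGraph ends s).ConnectedComponent := by
  rw [← Set.ncard_univ, ← Set.ncard_univ, ← ncard_image_componentMap hab (Set.mem_univ _)
    (Set.mem_univ _) hn, Set.image_univ, (componentMap_surjective _).range_eq]

end Reachability

/-! ### Merging components of enhanced states -/

namespace EnhancedState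

section

variable {V E : Type*} {ends : E → Sym2 V} {v : V}

/-- Comparing colors at vertices avoids transport between component types of different edge sets. -/
theorem ext_colorAt {S T : EnhancedState ends v} (h : S.edges = T.edges)
    (h' : ∀ u, S.colorAt u = Color.x ↔ T.colorAt u = Color.x) : S = T := by
  obtain ⟨s, c, hc⟩ := S
  obtain ⟨t, c', hc'⟩ := T
  obtain rfl : s = t := h
  congr
  funext K
  induction K using SimpleGraph.ConnectedComponent.ind with | h u => ?_
  have := h' u
  change c ((stateGraph ends s).connectedComponentMk u) = _ ↔
    c' ((stateGraph ends s).connectedComponentMk u) = _ at this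
  generalize c ((stateGraph ends s).connectedComponentMk u) = p at *
  generalize c' ((stateGraph ends s).connectedComponentMk u) = q at *
  cases p <;> cases q <;> simp_all

theorem colorAt_congr (S : EnhancedState ends v) {a b : V}
    (h : (stateGraph ends S.edges).Reachable a b) : S.colorAt a = S.colorAt b :=
  congrArg S.color (SimpleGraph.ConnectedComponent.eq.2 h)

theorem colorAt_base (S : EnhancedState ends v) : S.colorAt v = Color.x := S.base_color

open Classical in
/-- The enhanced state on the edge set `s` whose components colored `x` are those that meet `X`. -/
noncomputable def ofSet (s : Finset E) (X : Set V) (hv : v ∈ X) : EnhancedState ends v where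
  edges := s
  color K := if ∃ u : V, (stateGraph ends s).connectedComponentMk u = K ∧ u ∈ X then Color.x
    else Color.one
  base_color := if_pos ⟨v, rfl, hv⟩

open Classical in
theorem colorAt_ofSet {s : Finset E} {X : Set V} {hv : v ∈ X} {u : V} :
    (ofSet (ends := ends) s X hv).colorAt u = Color.x ↔
      ∃ w, (stateGraph ends s).Reachable w u ∧ w ∈ X := by
  change (if ∃ w : V, (stateGraph ends s).connectedComponentMk w =
    (stateGraph ends s).connectedComponentMk u ∧ w ∈ X then Color.x else Color.one) = _ ↔ _
  simp only [SimpleGraph.ConnectedComponent.eq]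
  split_ifs with h <;> simp [h]

theorem annihilates_iff (S : EnhancedState ends v) {e : E} {a b : V} (hab : ends e = s(a, b)) :
    S.Annihilates e ↔ ¬ (stateGraph ends S.edges).Reachable a b ∧ S.colorAt a = Color.x ∧
      S.colorAt b = Color.x := by
  constructor
  · rintro ⟨c, d, hcd, hne, hc, hd⟩
    have hne' : ¬ (stateGraph ends S.edges).Reachable c d :=
      fun h => hne (SimpleGraph.ConnectedComponent.eq.2 h)
    rw [hab, Sym2.eq_iff] at hcd
    rcases hcd with ⟨rfl, rfl⟩ | ⟨rfl, rfl⟩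
    · exact ⟨hne', hc, hd⟩
    · exact ⟨fun h => hne' h.symm, hd, hc⟩
  · rintro ⟨h, ha, hb⟩
    exact ⟨a, b, hab, fun h' => h (SimpleGraph.ConnectedComponent.eq.1 h'), ha, hb⟩

theorem annihilates_iff_of_reachable {S : EnhancedState ends v} {e : E} {a b : V}
    (hab : ends e = s(a, b))
    (hva : (stateGraph ends S.edges).Reachable v a) :
    S.Annihilates e ↔ ¬ (stateGraph ends S.edges).Reachable a b ∧ S.colorAt b = Color.x := by
  rw [annihilates_iff _ hab, ← S.colorAt_congr hva]
  simp [colorAt_base]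

end

variable {V E : Type*} [DecidableEq E] {ends : E → Sym2 V} {v : V}

theorem edges_addEdge (S : EnhancedState ends v) (e : E) :
    (S.addEdge e).edges = insert e S.edges := by
  ext f
  simp [addEdge]

theorem colorAt_addEdge (S : EnhancedState ends v) (e : E) (u : V) :
    (S.addEdge e).colorAt u = Color.x ↔
      ∃ w, (stateGraph ends (insert e S.edges)).Reachable w u ∧ S.colorAt w = Color.x := by
  rw [← edges_addEdge]
  exact colorAt_ofSet (ends := ends) (s := (S.addEdge e).edges) (X := {w | S.colorAt w = Color.x})
    (hv := S.base_color)

theorem colorAt_addEdge_of_colorAt {S : EnhancedState ends v} {e : E} {u : V}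
    (h : S.colorAt u = Color.x) : (S.addEdge e).colorAt u = Color.x :=
  (S.colorAt_addEdge e u).2 ⟨u, SimpleGraph.Reachable.refl _, h⟩

theorem colorAt_addEdge_addEdge (S : EnhancedState ends v) (e f : E) (u : V) :
    ((S.addEdge e).addEdge f).colorAt u = Color.x ↔
      ∃ w, (stateGraph ends (insert f (insert e S.edges))).Reachable w u ∧
        S.colorAt w = Color.x := by
  rw [colorAt_addEdge, edges_addEdge]
  constructor
  · rintro ⟨w, hw, hc⟩
    obtain ⟨w', hw', hc'⟩ := (S.colorAt_addEdge e w).1 hc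
    exact ⟨w', (reachable_mono (Finset.subset_insert _ _) hw').trans hw, hc'⟩
  · rintro ⟨w, hw, hc⟩
    exact ⟨w, hw, colorAt_addEdge_of_colorAt hc⟩

theorem addEdge_comm (S : EnhancedState ends v) (e f : E) :
    (S.addEdge e).addEdge f = (S.addEdge f).addEdge e := by
  refine ext_colorAt ?_ fun u => ?_
  · simp only [edges_addEdge, Finset.insert_comm]
  · rw [colorAt_addEdge_addEdge, colorAt_addEdge_addEdge, Finset.insert_comm]

theorem setOf_color_addEdge (S : EnhancedState ends v) (e : E) :
    Set.ncard {K | (S.addEdge e).color K = Color.x} =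
      (componentMap (ends := ends) (Finset.subset_insert e S.edges) ''
        {K | S.color K = Color.x}).ncard := by
  -- The edge set is a variable because `addEdge` inserts with classical decidability, so its edges
  -- match `insert e S.edges` only propositionally.
  have key : ∀ (s : Finset E) (T : EnhancedState ends v) (hs : T.edges = s) (h : S.edges ⊆ s),
      (∀ u, T.colorAt u = Color.x ↔
        ∃ w, (stateGraph ends s).Reachable w u ∧ S.colorAt w = Color.x) →
      Set.ncard {K | T.color K = Color.x} =
        (componentMap (ends := ends) h '' {K | S.color K = Color.x}).ncard := by
    rintro s T rfl h hT
    congr 1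
    ext K
    induction K using SimpleGraph.ConnectedComponent.ind with | h u => ?_
    refine (hT u).trans ?_
    constructor
    · rintro ⟨w, hw, hc⟩
      exact ⟨_, hc, SimpleGraph.ConnectedComponent.eq.2 hw⟩
    · rintro ⟨K, hK, hKu⟩
      induction K using SimpleGraph.ConnectedComponent.ind with | h w => ?_
      exact ⟨w, SimpleGraph.ConnectedComponent.eq.1 hKu, hK⟩
  exact key _ _ (S.edges_addEdge e) _ (S.colorAt_addEdge e)

-- `addEdge` colors even a forbidden merge by `x`, so an `x`-component is lost exactly when `x`
-- meets `x`. The degree drop thus counts annihilations.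
open Classical in
theorem degree_addEdge [Finite V] (S : EnhancedState ends v) (e : E) :
    (S.addEdge e).degree = S.degree - if S.Annihilates e then 1 else 0 := by
  obtain ⟨a, b, hab⟩ : ∃ a b, ends e = s(a, b) := by
    induction h : ends e with | _ a b => exact ⟨a, b, rfl⟩
  rw [degree, degree, setOf_color_addEdge]
  split_ifs with h
  · obtain ⟨hn, ha, hb⟩ := (S.annihilates_iff hab).1 h
    rw [← ncard_image_componentMap hab ha hb hn]
    push_cast
    ring
  · rw [Set.InjOn.ncard_image, sub_zero]
    refine componentMap_injOn hab fun ha hb => ?_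
    by_contra hn
    exact h ((S.annihilates_iff hab).2 ⟨hn, ha, hb⟩)

theorem dimension_addEdge {S : EnhancedState ends v} {e : E} (h : e ∉ S.edges) :
    (S.addEdge e).dimension = S.dimension + 1 := by
  rw [dimension, dimension, edges_addEdge, Finset.card_insert_of_notMem h]
  push_cast
  rfl

open Classical in
/-- Whether two successive merges avoid `x × x` does not depend on their order. -/
theorem not_annihilates_addEdge_iff [Finite V] (S : EnhancedState ends v) (e f : E) :
    (¬ S.Annihilates e ∧ ¬ (S.addEdge e).Annihilates f) ↔
      (¬ S.Annihilates f ∧ ¬ (S.addEdge f).Annihilates e) := by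
  -- Degree drops are nonnegative, so neither merge is forbidden iff the total drop is zero, and the
  -- total is symmetric in `e` and `f`.
  have key : ∀ e f, (¬ S.Annihilates e ∧ ¬ (S.addEdge e).Annihilates f) ↔
      ((S.addEdge e).addEdge f).degree = S.degree := by
    intro e f
    rw [degree_addEdge, degree_addEdge]
    split_ifs <;> simp_all
    omega
  rw [key, key, addEdge_comm]

open Classical in
/-- If `e` annihilates `S` and `S ∪ f`, then `f` annihilates `S` exactly if it annihilates
`S ∪ e`. -/
theorem annihilates_addEdge_iff [Finite V] {S : EnhancedState ends v} {e f : E}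
    (h : S.Annihilates e) (h' : (S.addEdge f).Annihilates e) :
    (S.addEdge e).Annihilates f ↔ S.Annihilates f := by
  -- Both orders have the same total degree drop; the drop due to `e` is one in each and cancels.
  have h1 := congrArg degree (S.addEdge_comm e f)
  simp only [degree_addEdge, h, h', if_true] at h1
  split_ifs at h1 with h2 h3 h3 <;> simp_all
  omega

end EnhancedState

/-! ### Removing an edge: inverses of forbidden and of allowed merges -/

namespace EnhancedState

variable {V E : Type*} [DecidableEq E] {ends : E → Sym2 V} {v : V}

/-- Remove the edge `e` and keep the color of every vertex. -/
noncomputable def split (T : EnhancedState ends v) (e : E) : EnhancedState ends v :=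
  ofSet (T.edges.erase e) {u | T.colorAt u = Color.x} T.base_color

/-- Remove the edge `e`; if the component of the base vertex falls apart, the part without the base
vertex is colored `1`. -/
noncomputable def lift (T : EnhancedState ends v) (e : E) : EnhancedState ends v :=
  ofSet (T.edges.erase e) {u | u = v ∨ T.colorAt u = Color.x ∧
    ¬ (stateGraph ends T.edges).Reachable u v} (Or.inl rfl)

theorem edges_split (T : EnhancedState ends v) (e : E) : (T.split e).edges = T.edges.erase e := rfl

theorem edges_lift (T : EnhancedState ends v) (e : E) : (T.lift e).edges = T.edges.erase e := rfl

theorem colorAt_split (T : EnhancedState ends v) (e : E) (u : V) :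
    (T.split e).colorAt u = Color.x ↔ T.colorAt u = Color.x := by
  refine colorAt_ofSet.trans ⟨?_, fun h => ⟨u, SimpleGraph.Reachable.refl _, h⟩⟩
  rintro ⟨w, hw, hc⟩
  exact (T.colorAt_congr (reachable_mono (Finset.erase_subset _ _) hw)) ▸ hc

theorem colorAt_lift (T : EnhancedState ends v) (e : E) (u : V) :
    (T.lift e).colorAt u = Color.x ↔ (stateGraph ends (T.edges.erase e)).Reachable u v ∨
      T.colorAt u = Color.x ∧ ¬ (stateGraph ends T.edges).Reachable u v := by
  refine colorAt_ofSet.trans ⟨?_, ?_⟩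
  · rintro ⟨w, hw, rfl | ⟨hc, hn⟩⟩
    · exact Or.inl hw.symm
    · have hw' := reachable_mono (Finset.erase_subset e _) hw
      exact Or.inr ⟨(T.colorAt_congr hw') ▸ hc, fun h => hn (hw'.trans h)⟩
  · rintro (h | h)
    · exact ⟨v, h.symm, Or.inl rfl⟩
    · exact ⟨u, SimpleGraph.Reachable.refl _, Or.inr h⟩

theorem addEdge_split {T : EnhancedState ends v} {e : E} (he : e ∈ T.edges) :
    (T.split e).addEdge e = T := by
  refine ext_colorAt ?_ fun u => ?_
  · rw [edges_addEdge, edges_split, Finset.insert_erase he]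
  · rw [colorAt_addEdge, edges_split, Finset.insert_erase he]
    simp only [colorAt_split]
    refine ⟨?_, fun h => ⟨u, SimpleGraph.Reachable.refl _, h⟩⟩
    rintro ⟨w, hw, hc⟩
    exact (T.colorAt_congr hw) ▸ hc

variable {e : E} {a b : V}

theorem annihilates_split {T : EnhancedState ends v} (hab : ends e = s(a, b)) (he : e ∈ T.edges)
    (hva : (stateGraph ends T.edges).Reachable v a)
    (hn : ¬ (stateGraph ends (T.edges.erase e)).Reachable a b) : (T.split e).Annihilates e := by
  have ha : T.colorAt a = Color.x := (T.colorAt_congr hva) ▸ T.colorAt_base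
  rw [annihilates_iff _ hab, colorAt_split, colorAt_split]
  exact ⟨hn, ha, (T.colorAt_congr (reachable_of_mem he hab)) ▸ ha⟩

theorem split_addEdge {S : EnhancedState ends v} (he : e ∉ S.edges) (h : S.Annihilates e) :
    (S.addEdge e).split e = S := by
  obtain ⟨a, b, hab, -, ha, hb⟩ := h
  refine ext_colorAt ?_ fun u => ?_
  · rw [edges_split, edges_addEdge, Finset.erase_insert he]
  · rw [colorAt_split]
    refine ⟨fun h => ?_, colorAt_addEdge_of_colorAt⟩
    obtain ⟨w, hw, hc⟩ := (S.colorAt_addEdge e u).1 h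
    rcases (reachable_insert_iff hab).1 hw with h | ⟨-, h⟩ | ⟨-, h⟩
    · exact (S.colorAt_congr h) ▸ hc
    · exact (S.colorAt_congr h) ▸ hb
    · exact (S.colorAt_congr h) ▸ ha

/-- In `T` the far end `b` lies in the base component; once `e` is removed it is either still joined
to `v`, hence to `a`, or recolored `1`. -/
theorem not_annihilates_lift {T : EnhancedState ends v} (hab : ends e = s(a, b)) (he : e ∈ T.edges)
    (hva : (stateGraph ends (T.edges.erase e)).Reachable v a) : ¬ (T.lift e).Annihilates e := by
  rw [annihilates_iff_of_reachable hab hva, colorAt_lift, edges_lift]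
  rintro ⟨hn, h | ⟨-, h⟩⟩
  · exact hn (hva.symm.trans h.symm)
  · exact h ((reachable_of_mem he hab).symm.trans (reachable_mono (Finset.erase_subset _ _) hva.symm))

theorem addEdge_lift {T : EnhancedState ends v} (he : e ∈ T.edges) :
    (T.lift e).addEdge e = T := by
  have hsub := Finset.erase_subset e T.edges
  refine ext_colorAt ?_ fun u => ?_
  · rw [edges_addEdge, edges_lift, Finset.insert_erase he]
  · rw [colorAt_addEdge, edges_lift, Finset.insert_erase he]
    simp only [colorAt_lift]
    constructor
    · rintro ⟨w, hw, h | ⟨hc, -⟩⟩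
      · rw [← T.colorAt_congr hw, T.colorAt_congr (reachable_mono hsub h), colorAt_base]
      · exact (T.colorAt_congr hw) ▸ hc
    · intro hc
      by_cases h : (stateGraph ends T.edges).Reachable u v
      · exact ⟨v, h.symm, Or.inl (SimpleGraph.Reachable.refl _)⟩
      · exact ⟨u, SimpleGraph.Reachable.refl _, Or.inr ⟨hc, h⟩⟩

/-- The end `a` is colored `x`, so an allowed merge of distinct components forces color `1` at `b`;
this is the color `lift` restores. -/
theorem lift_addEdge {S : EnhancedState ends v} (hab : ends e = s(a, b)) (he : e ∉ S.edges)
    (hva : (stateGraph ends S.edges).Reachable v a) (h : ¬ S.Annihilates e) :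
    (S.addEdge e).lift e = S := by
  rw [annihilates_iff_of_reachable hab hva] at h
  have hsub := Finset.subset_insert e S.edges
  have hins := reachable_of_mem (Finset.mem_insert_self e S.edges) hab
  refine ext_colorAt ?_ fun u => ?_
  · rw [edges_lift, edges_addEdge, Finset.erase_insert he]
  · rw [colorAt_lift, edges_addEdge, Finset.erase_insert he]
    constructor
    · rintro (h1 | ⟨h1, h2⟩)
      · rw [S.colorAt_congr h1, colorAt_base]
      · obtain ⟨w, hw, hc⟩ := (S.colorAt_addEdge e u).1 h1
        rcases (reachable_insert_iff hab).1 hw with h3 | ⟨-, h3⟩ | ⟨-, h3⟩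
        · exact (S.colorAt_congr h3) ▸ hc
        · exact absurd ((reachable_mono hsub h3).symm.trans
            (hins.symm.trans (reachable_mono hsub hva.symm))) h2
        · exact absurd ((reachable_mono hsub (h3.symm.trans hva.symm))) h2
    · intro hc
      by_cases h1 : (stateGraph ends S.edges).Reachable u v
      · exact Or.inl h1
      · refine Or.inr ⟨colorAt_addEdge_of_colorAt hc, fun h2 => ?_⟩
        rcases (reachable_insert_iff hab).1 h2 with h3 | ⟨h3, h4⟩ | ⟨h3, -⟩
        · exact h1 h3
        · exact h1 (h3.trans hva.symm)
        · refine h ⟨fun h4 => h1 (h3.trans (h4.symm.trans hva.symm)), ?_⟩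
          rw [← S.colorAt_congr h3, hc]

end EnhancedState

/-! ### Signed edge operators and their anticommutation -/

section Operators

variable {V E : Type*} [LinearOrder E] {ends : E → Sym2 V} {v : V}

/-- The sign with which the edge `e` is added to the edge set `s`. -/
def edgeSign (s : Finset E) (e : E) : ℝ := (-1) ^ (s.filter (· < e)).card

theorem edgeSign_mul_self (s : Finset E) (e : E) : edgeSign s e * edgeSign s e = 1 := by
  rw [edgeSign, ← mul_pow]
  norm_num

theorem edgeSign_insert {s : Finset E} {e : E} (f : E) (he : e ∉ s) :
    edgeSign (insert e s) f = (if e < f then -1 else 1) * edgeSign s f := by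
  rw [edgeSign, edgeSign, Finset.filter_insert]
  split_ifs
  · rw [Finset.card_insert_of_notMem (by simp [he]), pow_succ]
    ring
  · rw [one_mul]

/-- Adding the smaller edge first flips the sign of the larger one; the other order flips nothing.
-/
theorem edgeSign_anticomm {s : Finset E} {e f : E} (hef : e ≠ f) (he : e ∉ s) (hf : f ∉ s) :
    edgeSign s e * edgeSign (insert e s) f = -(edgeSign s f * edgeSign (insert f s) e) := by
  rw [edgeSign_insert f he, edgeSign_insert e hf]
  rcases lt_or_gt_of_ne hef with h | h <;> simp only [h, h.not_gt, if_true, if_false] <;> ring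

open Classical in
/-- The part of the differential that adds the edge `e`. -/
noncomputable def addOp (ends : E → Sym2 V) (v : V) (e : E) :
    (EnhancedState ends v →₀ ℝ) →ₗ[ℝ] (EnhancedState ends v →₀ ℝ) :=
  Finsupp.linearCombination ℝ fun S : EnhancedState ends v =>
    if e ∉ S.edges ∧ ¬ S.Annihilates e then Finsupp.single (S.addEdge e) (edgeSign S.edges e)
    else 0

/-- The part of the differential that adds edges in `F`. -/
noncomputable def partialDifferential (ends : E → Sym2 V) (v : V) (F : Finset E) :
    (EnhancedState ends v →₀ ℝ) →ₗ[ℝ] (EnhancedState ends v →₀ ℝ) :=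
  ∑ e ∈ F, addOp ends v e

/-- Add the edge `e`, also when this merges two components colored `x`. -/
noncomputable def forceOp (ends : E → Sym2 V) (v : V) (e : E) :
    (EnhancedState ends v →₀ ℝ) →ₗ[ℝ] (EnhancedState ends v →₀ ℝ) :=
  Finsupp.linearCombination ℝ fun S : EnhancedState ends v =>
    Finsupp.single (S.addEdge e) (edgeSign S.edges e)

/-- The linear extension of `EnhancedState.split`, with signs. -/
noncomputable def splitOp (ends : E → Sym2 V) (v : V) (e : E) :
    (EnhancedState ends v →₀ ℝ) →ₗ[ℝ] (EnhancedState ends v →₀ ℝ) :=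
  Finsupp.linearCombination ℝ fun T : EnhancedState ends v =>
    Finsupp.single (T.split e) (edgeSign (T.edges.erase e) e)

/-- The linear extension of `EnhancedState.lift`, with signs. -/
noncomputable def liftOp (ends : E → Sym2 V) (v : V) (e : E) :
    (EnhancedState ends v →₀ ℝ) →ₗ[ℝ] (EnhancedState ends v →₀ ℝ) :=
  Finsupp.linearCombination ℝ fun T : EnhancedState ends v =>
    Finsupp.single (T.lift e) (edgeSign (T.edges.erase e) e)

theorem differential_eq [Fintype E] (ends : E → Sym2 V) (v : V) :
    differential ends v = partialDifferential ends v Finset.univ := by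
  refine Finsupp.lhom_ext' fun S => LinearMap.ext_ring ?_
  simp only [LinearMap.comp_apply, Finsupp.lsingle_apply, differential, partialDifferential,
    LinearMap.sum_apply, addOp, Finsupp.linearCombination_single, one_smul, edgeSign]
  rw [Finset.sum_filter]
  refine Finset.sum_congr rfl fun e _ => ?_
  by_cases h1 : e ∈ S.edges <;> by_cases h2 : S.Annihilates e <;> simp [h1, h2]

variable {e f : E} (S : EnhancedState ends v) (r : ℝ)

theorem addOp_single_of_pos (h : e ∉ S.edges) (h' : ¬ S.Annihilates e) :
    addOp ends v e (Finsupp.single S r) =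
      Finsupp.single (S.addEdge e) (r * edgeSign S.edges e) := by
  simp [addOp, h, h']

theorem addOp_single_of_mem (h : e ∈ S.edges) : addOp ends v e (Finsupp.single S r) = 0 := by
  simp [addOp, h]

theorem addOp_single_of_annihilates (h : S.Annihilates e) :
    addOp ends v e (Finsupp.single S r) = 0 := by
  simp [addOp, h]

theorem forceOp_single : forceOp ends v e (Finsupp.single S r) =
    Finsupp.single (S.addEdge e) (r * edgeSign S.edges e) := by
  simp [forceOp]

theorem splitOp_single : splitOp ends v e (Finsupp.single S r) =
    Finsupp.single (S.split e) (r * edgeSign (S.edges.erase e) e) := by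
  simp [splitOp]

theorem liftOp_single : liftOp ends v e (Finsupp.single S r) =
    Finsupp.single (S.lift e) (r * edgeSign (S.edges.erase e) e) := by
  simp [liftOp]

theorem addOp_anticomm [Finite V] (e f : E) :
    addOp ends v e ∘ₗ addOp ends v f = -(addOp ends v f ∘ₗ addOp ends v e) := by
  refine Finsupp.lhom_ext' fun S => LinearMap.ext_ring ?_
  simp only [LinearMap.comp_apply, Finsupp.lsingle_apply, LinearMap.neg_apply]
  -- The conditions under which the composite can be nonzero are symmetric in `e` and `f`, so
  -- otherwise both composites vanish.
  have hzero : ∀ e f, ¬ (e ∉ S.edges ∧ f ∉ S.edges ∧ e ≠ f ∧ ¬ S.Annihilates f ∧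
      ¬ (S.addEdge f).Annihilates e) → addOp ends v e (addOp ends v f (Finsupp.single S 1)) = 0 := by
    intro e f h
    by_cases h1 : f ∈ S.edges
    · rw [addOp_single_of_mem _ _ h1, map_zero]
    by_cases h2 : S.Annihilates f
    · rw [addOp_single_of_annihilates _ _ h2, map_zero]
    rw [addOp_single_of_pos _ _ h1 h2]
    by_cases h3 : e ∈ (S.addEdge f).edges
    · rw [addOp_single_of_mem _ _ h3]
    by_cases h4 : (S.addEdge f).Annihilates e
    · rw [addOp_single_of_annihilates _ _ h4]
    · rw [S.edges_addEdge, Finset.mem_insert, not_or] at h3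
      exact absurd ⟨h3.2, h1, h3.1, h2, h4⟩ h
  by_cases h : e ∉ S.edges ∧ f ∉ S.edges ∧ e ≠ f ∧ ¬ S.Annihilates f ∧ ¬ (S.addEdge f).Annihilates e
  · obtain ⟨he, hf, hef, h1, h2⟩ := h
    obtain ⟨h3, h4⟩ := (S.not_annihilates_addEdge_iff f e).1 ⟨h1, h2⟩
    rw [addOp_single_of_pos _ _ hf h1, addOp_single_of_pos _ _ he h3,
      addOp_single_of_pos _ _ (by simp [S.edges_addEdge, he, hef]) h2,
      addOp_single_of_pos _ _ (by simp [S.edges_addEdge, hf, hef.symm]) h4,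
      S.addEdge_comm, ← Finsupp.single_neg, S.edges_addEdge, S.edges_addEdge, one_mul, one_mul,
      edgeSign_anticomm hef.symm hf he]
  · rw [hzero e f h, hzero f e, neg_zero]
    contrapose! h
    obtain ⟨hf, he, hef, h1, h2⟩ := h
    have h3 := (S.not_annihilates_addEdge_iff e f).1 ⟨h1, h2⟩
    exact ⟨he, hf, hef.symm, h3.1, h3.2⟩

theorem partialDifferential_partialDifferential [Finite V] (F : Finset E)
    (z : EnhancedState ends v →₀ ℝ) :
    partialDifferential ends v F (partialDifferential ends v F z) = 0 := by
  -- Swapping the two summations shows that `d ∘ d` equals its own negative.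
  have h : partialDifferential ends v F (partialDifferential ends v F z) =
      -partialDifferential ends v F (partialDifferential ends v F z) := by
    simp only [partialDifferential, LinearMap.sum_apply, map_sum]
    rw [← Finset.sum_neg_distrib, Finset.sum_comm]
    refine Finset.sum_congr rfl fun e _ => ?_
    rw [← Finset.sum_neg_distrib]
    exact Finset.sum_congr rfl fun f _ => LinearMap.congr_fun (addOp_anticomm e f) z
  ext S
  have hS := DFunLike.congr_fun h S
  rw [Finsupp.neg_apply] at hS
  rw [Finsupp.zero_apply]
  linarith

/-- If `e` is a forbidden merge both before and after adding `f`, forcing it does not affect whether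
`f` is forbidden, and only the edge signs differ. -/
theorem forceOp_anticomm [Finite V] {S : EnhancedState ends v} (hef : e ≠ f) (he : e ∉ S.edges)
    (h : S.Annihilates e) (h' : (S.addEdge f).Annihilates e) :
    addOp ends v f (forceOp ends v e (Finsupp.single S 1)) =
      -forceOp ends v e (addOp ends v f (Finsupp.single S 1)) := by
  have hiff := EnhancedState.annihilates_addEdge_iff h h'
  rw [forceOp_single]
  by_cases hf : f ∈ S.edges
  · rw [addOp_single_of_mem _ _ hf, addOp_single_of_mem _ _ (by simp [S.edges_addEdge, hf]),
      map_zero, neg_zero]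
  by_cases h1 : S.Annihilates f
  · rw [addOp_single_of_annihilates _ _ h1, addOp_single_of_annihilates _ _ (hiff.2 h1), map_zero,
      neg_zero]
  · rw [addOp_single_of_pos _ _ hf h1, forceOp_single,
      addOp_single_of_pos _ _ (by simp [S.edges_addEdge, hf, hef.symm]) (hiff.not.2 h1),
      S.addEdge_comm, ← Finsupp.single_neg, S.edges_addEdge, S.edges_addEdge, one_mul, one_mul,
      edgeSign_anticomm hef he hf]

theorem forceOp_splitOp {T : EnhancedState ends v} (he : e ∈ T.edges) :
    forceOp ends v e (splitOp ends v e (Finsupp.single T 1)) = Finsupp.single T 1 := by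
  rw [splitOp_single, forceOp_single, T.addEdge_split he, T.edges_split, mul_assoc,
    edgeSign_mul_self, one_mul]

theorem splitOp_forceOp {S : EnhancedState ends v} (he : e ∉ S.edges) (h : S.Annihilates e) :
    splitOp ends v e (forceOp ends v e (Finsupp.single S 1)) = Finsupp.single S 1 := by
  rw [forceOp_single, splitOp_single, S.split_addEdge he h, S.edges_addEdge,
    Finset.erase_insert he, mul_assoc, edgeSign_mul_self, one_mul]

theorem addOp_liftOp {T : EnhancedState ends v} {a b : V} (hab : ends e = s(a, b))
    (he : e ∈ T.edges) (hva : (stateGraph ends (T.edges.erase e)).Reachable v a) :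
    addOp ends v e (liftOp ends v e (Finsupp.single T 1)) = Finsupp.single T 1 := by
  rw [liftOp_single, addOp_single_of_pos _ _ (by simp [T.edges_lift])
    (T.not_annihilates_lift hab he hva), T.addEdge_lift he, T.edges_lift, mul_assoc,
    edgeSign_mul_self, one_mul]

theorem liftOp_addOp {S : EnhancedState ends v} {a b : V} (hab : ends e = s(a, b))
    (he : e ∉ S.edges) (hva : (stateGraph ends S.edges).Reachable v a) (h : ¬ S.Annihilates e) :
    liftOp ends v e (addOp ends v e (Finsupp.single S 1)) = Finsupp.single S 1 := by
  rw [addOp_single_of_pos _ _ he h, liftOp_single, S.lift_addEdge hab he hva h, S.edges_addEdge,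
    Finset.erase_insert he, mul_assoc, edgeSign_mul_self, one_mul]

end Operators

/-! ### Linear maps on supported functions -/

section Supported

variable {α : Type*} {s t : Set α}

theorem map_mem_supported {f : (α →₀ ℝ) →ₗ[ℝ] (α →₀ ℝ)}
    (h : ∀ S ∈ s, f (Finsupp.single S 1) ∈ Finsupp.supported ℝ ℝ t) {z : α →₀ ℝ}
    (hz : z ∈ Finsupp.supported ℝ ℝ s) : f z ∈ Finsupp.supported ℝ ℝ t := by
  have hle : Finsupp.supported ℝ ℝ s ≤ (Finsupp.supported ℝ ℝ t).comap f := by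
    rw [Finsupp.supported_eq_span_single, Submodule.span_le]
    rintro _ ⟨S, hS, rfl⟩
    exact h S hS
  exact hle hz

theorem eqOn_supported {f g : (α →₀ ℝ) →ₗ[ℝ] (α →₀ ℝ)}
    (h : ∀ S ∈ s, f (Finsupp.single S 1) = g (Finsupp.single S 1)) {z : α →₀ ℝ}
    (hz : z ∈ Finsupp.supported ℝ ℝ s) : f z = g z := by
  rw [Finsupp.supported_eq_span_single] at hz
  refine LinearMap.eqOn_span (f := f) (g := g) ?_ hz
  rintro _ ⟨S, hS, rfl⟩
  exact h S hS

theorem eq_zero_of_add_eq_zero_of_supported (hst : Disjoint s t) {x y : α →₀ ℝ}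
    (hx : x ∈ Finsupp.supported ℝ ℝ s) (hy : y ∈ Finsupp.supported ℝ ℝ t) (h : x + y = 0) :
    x = 0 ∧ y = 0 := by
  have hx0 : x = 0 := Submodule.disjoint_def.1 (Finsupp.disjoint_supported_supported hst) x hx
    (by rw [eq_neg_of_add_eq_zero_left h]; exact neg_mem hy)
  exact ⟨hx0, by rwa [hx0, zero_add] at h⟩

end Supported

/-! ### Complexes of states between two edge sets -/

variable {V E : Type*} [LinearOrder E] {ends : E → Sym2 V} {v : V}

/-- The states of bidegree `(i, j)` whose edge set contains `s` and is contained in `s ∪ F`. -/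
def stateInterval (ends : E → Sym2 V) (v : V) (s F : Finset E) (i j : ℤ) :
    Set (EnhancedState ends v) :=
  {S | s ⊆ S.edges ∧ S.edges ⊆ s ∪ F ∧ S.dimension = i ∧ S.degree = j}

/-- The cochains supported on `stateInterval`. -/
abbrev intervalCochains (ends : E → Sym2 V) (v : V) (s F : Finset E) (i j : ℤ) :
    Submodule ℝ (EnhancedState ends v →₀ ℝ) :=
  Finsupp.supported ℝ ℝ (stateInterval ends v s F i j)

variable {s F : Finset E} {e : E} {a b : V} {i j : ℤ}

theorem addOp_single_mem {X : Set (EnhancedState ends v)} {S : EnhancedState ends v}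
    (h : e ∉ S.edges → ¬ S.Annihilates e → S.addEdge e ∈ X) :
    addOp ends v e (Finsupp.single S 1) ∈ Finsupp.supported ℝ ℝ X := by
  by_cases h1 : e ∈ S.edges
  · rw [addOp_single_of_mem _ _ h1]
    exact zero_mem _
  by_cases h2 : S.Annihilates e
  · rw [addOp_single_of_annihilates _ _ h2]
    exact zero_mem _
  · rw [addOp_single_of_pos _ _ h1 h2]
    exact Finsupp.single_mem_supported _ _ (h h1 h2)

theorem addEdge_mem_stateInterval [Finite V] (he : e ∈ F) {S : EnhancedState ends v}
    (hS : S ∈ stateInterval ends v s F i j) (h1 : e ∉ S.edges) (h2 : ¬ S.Annihilates e) :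
    S.addEdge e ∈ stateInterval ends v s F (i + 1) j := by
  obtain ⟨h3, h4, rfl, rfl⟩ := hS
  refine ⟨?_, ?_, EnhancedState.dimension_addEdge h1, by simp [S.degree_addEdge, h2]⟩
  · rw [S.edges_addEdge]
    exact h3.trans (Finset.subset_insert _ _)
  · rw [S.edges_addEdge]
    exact Finset.insert_subset (Finset.mem_union_right _ he) h4

theorem partialDifferential_mem_supported {X Y : Set (EnhancedState ends v)}
    (h : ∀ S ∈ X, ∀ e ∈ F, e ∉ S.edges → ¬ S.Annihilates e → S.addEdge e ∈ Y)
    {z : EnhancedState ends v →₀ ℝ} (hz : z ∈ Finsupp.supported ℝ ℝ X) :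
    partialDifferential ends v F z ∈ Finsupp.supported ℝ ℝ Y := by
  rw [partialDifferential, LinearMap.sum_apply]
  exact sum_mem fun e he => map_mem_supported (fun S hS => addOp_single_mem (h S hS e he)) hz

theorem partialDifferential_mem [Finite V] {z : EnhancedState ends v →₀ ℝ}
    (hz : z ∈ intervalCochains ends v s F i j) :
    partialDifferential ends v F z ∈ intervalCochains ends v s F (i + 1) j :=
  partialDifferential_mem_supported (fun _ hS _ he => addEdge_mem_stateInterval he hS) hz

theorem partialDifferential_insert (he : e ∉ F) (z : EnhancedState ends v →₀ ℝ) :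
    partialDifferential ends v (insert e F) z =
      addOp ends v e z + partialDifferential ends v F z := by
  simp [partialDifferential, Finset.sum_insert he]

/-- States without `e` form the deletion piece; those with `e` form the contraction piece. -/
theorem stateInterval_insert : stateInterval ends v s (insert e F) i j =
    stateInterval ends v s F i j ∪ stateInterval ends v (insert e s) F i j := by
  ext S
  constructor
  · rintro ⟨h1, h2, h3⟩
    rw [Finset.union_insert] at h2
    by_cases h : e ∈ S.edges
    · exact Or.inr ⟨Finset.insert_subset h h1, by rwa [Finset.insert_union], h3⟩
    · exact Or.inl ⟨h1, (Finset.subset_insert_iff_of_notMem h).1 h2, h3⟩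
  · rintro (⟨h1, h2, h3⟩ | ⟨h1, h2, h3⟩)
    · exact ⟨h1, h2.trans (Finset.union_subset_union_right (Finset.subset_insert _ _)), h3⟩
    · exact ⟨(Finset.subset_insert _ _).trans h1,
        by rwa [Finset.union_insert, ← Finset.insert_union], h3⟩

theorem notMem_edges (hs : e ∉ s) (hF : e ∉ F) {S : EnhancedState ends v}
    (h : S ∈ stateInterval ends v s F i j) : e ∉ S.edges := fun h' => by
  simpa [hs, hF] using h.2.1 h'

theorem mem_edges {S : EnhancedState ends v} (h : S ∈ stateInterval ends v (insert e s) F i j) :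
    e ∈ S.edges := h.1 (Finset.mem_insert_self _ _)

theorem disjoint_stateInterval (hs : e ∉ s) (hF : e ∉ F) {i' j' : ℤ} :
    Disjoint (stateInterval ends v s F i j) (stateInterval ends v (insert e s) F i' j') :=
  Set.disjoint_left.2 fun _ h h' => notMem_edges hs hF h (mem_edges h')

theorem addOp_eq_zero {z : EnhancedState ends v →₀ ℝ}
    (hz : z ∈ intervalCochains ends v (insert e s) F i j) : addOp ends v e z = 0 :=
  (eqOn_supported (g := 0) (fun _ hS => addOp_single_of_mem _ _ (mem_edges hS)) hz :)

theorem addOp_mem [Finite V] (hs : e ∉ s) (hF : e ∉ F) {z : EnhancedState ends v →₀ ℝ}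
    (hz : z ∈ intervalCochains ends v s F i j) :
    addOp ends v e z ∈ intervalCochains ends v (insert e s) F (i + 1) j := by
  refine map_mem_supported (fun S hS => addOp_single_mem fun h1 h2 => ?_) hz
  have hS' : S ∈ stateInterval ends v s (insert e F) i j := by
    rw [stateInterval_insert]
    exact Or.inl hS
  have h := addEdge_mem_stateInterval (Finset.mem_insert_self e F) hS' h1 h2
  rw [stateInterval_insert] at h
  refine h.resolve_left fun h' => notMem_edges hs hF h' ?_
  rw [S.edges_addEdge]
  exact Finset.mem_insert_self _ _

theorem cocycle_components [Finite V] (hs : e ∉ s) (hF : e ∉ F) {x y : EnhancedState ends v →₀ ℝ}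
    (hx : x ∈ intervalCochains ends v s F i j)
    (hy : y ∈ intervalCochains ends v (insert e s) F i j)
    (h : partialDifferential ends v (insert e F) (x + y) = 0) :
    partialDifferential ends v F x = 0 ∧
      addOp ends v e x + partialDifferential ends v F y = 0 := by
  rw [partialDifferential_insert hF, map_add, map_add, addOp_eq_zero hy, add_zero,
    add_left_comm] at h
  exact eq_zero_of_add_eq_zero_of_supported (disjoint_stateInterval hs hF)
    (partialDifferential_mem hx) (add_mem (addOp_mem hs hF hx) (partialDifferential_mem hy)) h

theorem liftOp_mem [Finite V] (hs : e ∉ s) (hab : ends e = s(a, b))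
    (hva : (stateGraph ends s).Reachable v a) {z : EnhancedState ends v →₀ ℝ}
    (hz : z ∈ intervalCochains ends v (insert e s) F i j) :
    liftOp ends v e z ∈ intervalCochains ends v s F (i - 1) j ∧
      addOp ends v e (liftOp ends v e z) = z := by
  have hva' : ∀ T ∈ stateInterval ends v (insert e s) F i j,
      (stateGraph ends (T.edges.erase e)).Reachable v a := fun T hT =>
    reachable_mono (Finset.subset_erase.2 ⟨(Finset.subset_insert _ _).trans hT.1, hs⟩) hva
  constructor
  · refine map_mem_supported (fun T hT => ?_) hz
    rw [liftOp_single]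
    refine Finsupp.single_mem_supported _ _ ?_
    have he := mem_edges hT
    have hadd := T.addEdge_lift he
    have hn := T.not_annihilates_lift hab he (hva' T hT)
    -- The bidegree of the lift is read off by adding `e` back, an allowed merge that returns `T`.
    have hdim := EnhancedState.dimension_addEdge (S := T.lift e) (e := e) (by simp [T.edges_lift])
    have hdeg := (T.lift e).degree_addEdge e
    rw [hadd] at hdim hdeg
    obtain ⟨h1, h2, rfl, rfl⟩ := hT
    refine ⟨Finset.subset_erase.2 ⟨(Finset.subset_insert _ _).trans h1, hs⟩, ?_, by omega,
      by simpa [hn] using hdeg.symm⟩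
    rw [T.edges_lift, ← Finset.subset_insert_iff, ← Finset.insert_union]
    exact h2
  · exact eqOn_supported (f := addOp ends v e ∘ₗ liftOp ends v e) (g := LinearMap.id)
      (fun T hT => addOp_liftOp hab (mem_edges hT) (hva' T hT)) hz

/-- The states of a `stateInterval` that are annihilated by `e`. -/
def annihilatedStates (ends : E → Sym2 V) (v : V) (s F : Finset E) (e : E) (i j : ℤ) :
    Set (EnhancedState ends v) :=
  {S ∈ stateInterval ends v s F i j | S.Annihilates e}

/-- Adding `e` kills the annihilated states and is injective, with left inverse `liftOp`, on the
span of the others. -/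
theorem mem_supported_annihilatedStates (hs : e ∉ s) (hF : e ∉ F) (hab : ends e = s(a, b))
    (hva : (stateGraph ends s).Reachable v a) {z : EnhancedState ends v →₀ ℝ}
    (hz : z ∈ intervalCochains ends v s F i j) (h : addOp ends v e z = 0) :
    z ∈ Finsupp.supported ℝ ℝ (annihilatedStates ends v s F e i j) := by
  have hsub : stateInterval ends v s F i j ⊆ {S ∈ stateInterval ends v s F i j |
      ¬ S.Annihilates e} ∪ annihilatedStates ends v s F e i j := fun S hS => by
    by_cases h : S.Annihilates e
    · exact Or.inr ⟨hS, h⟩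
    · exact Or.inl ⟨hS, h⟩
  have hz' := Finsupp.supported_mono hsub hz
  rw [Finsupp.supported_union, Submodule.mem_sup] at hz'
  obtain ⟨x, hx, y, hy, rfl⟩ := hz'
  have hy0 : addOp ends v e y = 0 :=
    (eqOn_supported (g := 0) (fun S hS => addOp_single_of_annihilates _ _ hS.2) hy :)
  have hx0 : liftOp ends v e (addOp ends v e x) = x :=
    eqOn_supported (f := liftOp ends v e ∘ₗ addOp ends v e) (g := LinearMap.id)
      (fun S hS => liftOp_addOp hab (notMem_edges hs hF hS.1) (reachable_mono hS.1.1 hva) hS.2) hx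
  rw [map_add, hy0, add_zero] at h
  rw [← hx0, h, map_zero, zero_add]
  exact hy

/-- Up to a coboundary, a cochain avoids the edge `e`. -/
theorem exists_sub_mem [Finite V] (hs : e ∉ s) (hF : e ∉ F) (hab : ends e = s(a, b))
    (hva : (stateGraph ends s).Reachable v a) {z : EnhancedState ends v →₀ ℝ}
    (hz : z ∈ intervalCochains ends v s (insert e F) i j) :
    ∃ y ∈ intervalCochains ends v s F (i - 1) j,
      z - partialDifferential ends v (insert e F) y ∈ intervalCochains ends v s F i j := by
  rw [intervalCochains, stateInterval_insert, Finsupp.supported_union, Submodule.mem_sup] at hz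
  -- The part `y` containing `e` equals `addOp` of its lift, so the differential of the lift cancels
  -- it, leaving only terms without `e`.
  obtain ⟨x, hx, y, hy, rfl⟩ := hz
  obtain ⟨h1, h2⟩ := liftOp_mem hs hab hva hy
  refine ⟨_, h1, ?_⟩
  rw [partialDifferential_insert hF, h2, add_comm x, add_sub_add_left_eq_sub]
  have h3 := partialDifferential_mem h1
  rw [sub_add_cancel] at h3
  exact sub_mem hx h3

/-! ### Bridges: annihilated states as a shifted contracted complex -/

section Bridge

/-- Edges of `s ∪ F` never join the ends of a bridge, and color `x` survives merging. -/
theorem annihilates_addEdge (hab : ends e = s(a, b))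
    (hn : ¬ (stateGraph ends (s ∪ F)).Reachable a b) {S : EnhancedState ends v}
    (hS : S ∈ annihilatedStates ends v s F e i j) {f : E} (hf : f ∈ F) :
    (S.addEdge f).Annihilates e := by
  obtain ⟨-, ha, hb⟩ := (S.annihilates_iff hab).1 hS.2
  refine ((S.addEdge f).annihilates_iff hab).2 ⟨fun h => hn (reachable_mono ?_ h),
    EnhancedState.colorAt_addEdge_of_colorAt ha, EnhancedState.colorAt_addEdge_of_colorAt hb⟩
  rw [S.edges_addEdge]
  exact Finset.insert_subset (Finset.mem_union_right _ hf) hS.1.2.1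

variable [Finite V]

theorem partialDifferential_mem_annihilatedStates (hab : ends e = s(a, b))
    (hn : ¬ (stateGraph ends (s ∪ F)).Reachable a b)
    {z : EnhancedState ends v →₀ ℝ}
    (hz : z ∈ Finsupp.supported ℝ ℝ (annihilatedStates ends v s F e i j)) :
    partialDifferential ends v F z ∈
      Finsupp.supported ℝ ℝ (annihilatedStates ends v s F e (i + 1) j) := by
  refine partialDifferential_mem_supported (fun S hS f hf h1 h2 => ?_) hz
  exact ⟨addEdge_mem_stateInterval hf hS.1 h1 h2, annihilates_addEdge hab hn hS hf⟩

theorem forceOp_mem (hs : e ∉ s) (hF : e ∉ F) {z : EnhancedState ends v →₀ ℝ}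
    (hz : z ∈ Finsupp.supported ℝ ℝ (annihilatedStates ends v s F e i j)) :
    forceOp ends v e z ∈ intervalCochains ends v (insert e s) F (i + 1) (j - 1) := by
  refine map_mem_supported (fun S hS => ?_) hz
  rw [forceOp_single]
  refine Finsupp.single_mem_supported _ _ ?_
  have he := notMem_edges hs hF hS.1
  obtain ⟨⟨h1, h2, rfl, rfl⟩, h3⟩ := hS
  refine ⟨?_, ?_, EnhancedState.dimension_addEdge he, by simp [S.degree_addEdge, h3]⟩
  · rw [S.edges_addEdge]
    exact Finset.insert_subset_insert _ h1
  · rw [S.edges_addEdge, Finset.insert_union]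
    exact Finset.insert_subset_insert _ h2

theorem partialDifferential_forceOp (hs : e ∉ s) (hF : e ∉ F) (hab : ends e = s(a, b))
    (hn : ¬ (stateGraph ends (s ∪ F)).Reachable a b)
    {z : EnhancedState ends v →₀ ℝ}
    (hz : z ∈ Finsupp.supported ℝ ℝ (annihilatedStates ends v s F e i j)) :
    partialDifferential ends v F (forceOp ends v e z) =
      -forceOp ends v e (partialDifferential ends v F z) := by
  simp only [partialDifferential, LinearMap.sum_apply, map_sum]
  rw [← Finset.sum_neg_distrib]
  refine Finset.sum_congr rfl fun f hf => ?_
  refine eqOn_supported (f := addOp ends v f ∘ₗ forceOp ends v e)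
    (g := -(forceOp ends v e ∘ₗ addOp ends v f)) (fun S hS => ?_) hz
  exact forceOp_anticomm (fun h => hF (h ▸ hf)) (notMem_edges hs hF hS.1) hS.2
    (annihilates_addEdge hab hn hS hf)

/-- Both ends of `e` lie in the base component of a state containing `e`. Removing the bridge
separates them, both still colored `x`, so the degree rises by one. -/
theorem splitOp_mem (hs : e ∉ s) (hab : ends e = s(a, b))
    (hva : (stateGraph ends s).Reachable v a) (hn : ¬ (stateGraph ends (s ∪ F)).Reachable a b)
    {z : EnhancedState ends v →₀ ℝ}
    (hz : z ∈ intervalCochains ends v (insert e s) F i j) :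
    splitOp ends v e z ∈
      Finsupp.supported ℝ ℝ (annihilatedStates ends v s F e (i - 1) (j + 1)) := by
  refine map_mem_supported (fun T hT => ?_) hz
  rw [splitOp_single]
  refine Finsupp.single_mem_supported _ _ ?_
  have he := mem_edges hT
  obtain ⟨h1, h2, rfl, rfl⟩ := hT
  have hsub : T.edges.erase e ⊆ s ∪ F := by
    rw [← Finset.subset_insert_iff, ← Finset.insert_union]
    exact h2
  have hann := T.annihilates_split hab he (reachable_mono ((Finset.subset_insert _ _).trans h1) hva)
    fun h => hn (reachable_mono hsub h)
  have hadd := T.addEdge_split he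
  have hdim := EnhancedState.dimension_addEdge (S := T.split e) (e := e) (by simp [T.edges_split])
  have hdeg := (T.split e).degree_addEdge e
  rw [hadd] at hdim hdeg
  rw [if_pos hann] at hdeg
  exact ⟨⟨Finset.subset_erase.2 ⟨(Finset.subset_insert _ _).trans h1, hs⟩, hsub, by omega,
    by omega⟩, hann⟩

end Bridge

/-! ### Exactness off the diagonal -/

section Vanishing

variable {V E : Type*} [LinearOrder E] {ends : E → Sym2 V} {v : V}

/-- Connectedness and the base color leave just one state, which lies on the diagonal. -/
theorem stateInterval_empty {s : Finset E} (hc : (stateGraph ends s).Preconnected) {i j : ℤ}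
    (hij : i + j ≠ Nat.card (stateGraph ends s).ConnectedComponent + s.card - 1) :
    stateInterval ends v s ∅ i j = ∅ := by
  refine Set.eq_empty_of_forall_notMem ?_
  rintro S ⟨h1, h2, rfl, rfl⟩
  rw [Finset.union_empty] at h2
  obtain rfl : S.edges = s := h2.antisymm h1
  have hcol : {K | S.color K = Color.x} = Set.univ := by
    refine Set.eq_univ_of_forall fun K => ?_
    induction K using SimpleGraph.ConnectedComponent.ind with | h u => ?_
    exact (S.colorAt_congr (hc u v)).trans S.colorAt_base
  rw [EnhancedState.degree, hcol, Set.ncard_univ, EnhancedState.dimension] at hij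
  omega

/-- An edge that leaves the component of the base vertex, or has both ends in it. -/
theorem exists_edge_at_base {s F : Finset E} (hc : (stateGraph ends (s ∪ F)).Preconnected)
    (hF : F.Nonempty) (v : V) :
    ∃ e ∈ F, ∃ a b, ends e = s(a, b) ∧ (stateGraph ends s).Reachable v a := by
  by_contra! hne
  -- If no edge of `F` touches the base component of `s`, that component is closed under all edges,
  -- hence is everything; then any edge of `F` touches it.
  have hall : ∀ u, (stateGraph ends s).Reachable v u := by
    intro u
    refine (rel_of_reachable (r := fun x y => (stateGraph ends s).Reachable v x ↔
      (stateGraph ends s).Reachable v y) ⟨fun _ => Iff.rfl, Iff.symm, Iff.trans⟩ ?_ (hc v u)).1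
      (SimpleGraph.Reachable.refl _)
    intro e he x y hxy
    rcases Finset.mem_union.1 he with he | he
    · have := reachable_of_mem he hxy
      exact ⟨fun h => h.trans this, fun h => h.trans this.symm⟩
    · exact iff_of_false (hne e he x y hxy) (hne e he y x (hxy.trans Sym2.eq_swap))
  obtain ⟨e, he⟩ := hF
  obtain ⟨a, b, hab⟩ : ∃ a b, ends e = s(a, b) := by
    induction h : ends e with | _ a b => exact ⟨a, b, rfl⟩
  exact hne e he a b hab (hall a)

variable {s F : Finset E} {e : E} {a b : V} {i j : ℤ}

/-- The cochains supported on a `stateInterval` are exact in bidegree `(i, j)`. -/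
def ExactAt (ends : E → Sym2 V) (v : V) (s F : Finset E) (i j : ℤ) : Prop :=
  ∀ z ∈ intervalCochains ends v s F i j, partialDifferential ends v F z = 0 →
    ∃ y ∈ intervalCochains ends v s F (i - 1) j, partialDifferential ends v F y = z

theorem intervalCochains_le_insert : intervalCochains ends v s F i j ≤
    intervalCochains ends v s (insert e F) i j := by
  refine Finsupp.supported_mono ?_
  rw [stateInterval_insert]
  exact Set.subset_union_left

theorem intervalCochains_insert_le_insert : intervalCochains ends v (insert e s) F i j ≤
    intervalCochains ends v s (insert e F) i j := by
  refine Finsupp.supported_mono ?_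
  rw [stateInterval_insert]
  exact Set.subset_union_right

variable [Finite V]

/-- Subtracting a coboundary removes the terms containing `e`; the cocycle condition then also gives
`addOp ends v e x = 0`, so only annihilated states remain. -/
theorem exactAt_of_cocycles (hs : e ∉ s) (hF : e ∉ F) (hab : ends e = s(a, b))
    (hva : (stateGraph ends s).Reachable v a)
    (h : ∀ z ∈ Finsupp.supported ℝ ℝ (annihilatedStates ends v s F e i j),
      partialDifferential ends v F z = 0 →
      ∃ y ∈ intervalCochains ends v s (insert e F) (i - 1) j,
        partialDifferential ends v (insert e F) y = z) :
    ExactAt ends v s (insert e F) i j := by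
  intro z hz hdz
  obtain ⟨y, hy, hzy⟩ := exists_sub_mem hs hF hab hva hz
  set x := z - partialDifferential ends v (insert e F) y with hx
  have hdx : partialDifferential ends v (insert e F) (x + 0) = 0 := by
    rw [hx, add_zero, map_sub, hdz, partialDifferential_partialDifferential, sub_zero]
  obtain ⟨h1, h2⟩ := cocycle_components hs hF hzy (zero_mem _) hdx
  rw [map_zero, add_zero] at h2
  obtain ⟨y', hy', hxy'⟩ := h x (mem_supported_annihilatedStates hs hF hab hva hzy h2) h1
  refine ⟨y' + y, add_mem hy' (intervalCochains_le_insert hy), ?_⟩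
  rw [map_add, hxy', hx, sub_add_cancel]

theorem exactAt_of_loop (hs : e ∉ s) (hF : e ∉ F) (hab : ends e = s(a, b))
    (hva : (stateGraph ends s).Reachable v a) (h : (stateGraph ends s).Reachable a b) :
    ExactAt ends v s (insert e F) i j := by
  refine exactAt_of_cocycles hs hF hab hva fun z hz _ => ⟨0, zero_mem _, ?_⟩
  have hempty : annihilatedStates ends v s F e i j = ∅ := by
    refine Set.eq_empty_of_forall_notMem fun S hS => ?_
    exact ((S.annihilates_iff hab).1 hS.2).1 (reachable_mono hS.1.1 h)
  rw [hempty, Finsupp.supported_empty, Submodule.mem_bot] at hz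
  rw [hz, map_zero]

/-- `forceOp` and `splitOp` are inverse maps between annihilated states and contracted cochains, and
`forceOp` anticommutes with the differential. -/
theorem exactAt_of_bridge (hs : e ∉ s) (hF : e ∉ F) (hab : ends e = s(a, b))
    (hva : (stateGraph ends s).Reachable v a) (hn : ¬ (stateGraph ends (s ∪ F)).Reachable a b)
    (h : ExactAt ends v (insert e s) F (i + 1) (j - 1)) :
    ExactAt ends v s (insert e F) i j := by
  have hinv : ∀ {i j} {x : EnhancedState ends v →₀ ℝ},
      x ∈ Finsupp.supported ℝ ℝ (annihilatedStates ends v s F e i j) →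
      splitOp ends v e (forceOp ends v e x) = x := fun hx =>
    eqOn_supported (f := splitOp ends v e ∘ₗ forceOp ends v e) (g := LinearMap.id)
      (fun S hS => splitOp_forceOp (notMem_edges hs hF hS.1) hS.2) hx
  refine exactAt_of_cocycles hs hF hab hva fun z hz hdz => ?_
  obtain ⟨t, ht, hdt⟩ := h _ (forceOp_mem hs hF hz) (by
    rw [partialDifferential_forceOp hs hF hab hn hz, hdz, map_zero, neg_zero])
  have hy := splitOp_mem hs hab hva hn ht
  have hyt : forceOp ends v e (splitOp ends v e t) = t :=
    eqOn_supported (f := forceOp ends v e ∘ₗ splitOp ends v e) (g := LinearMap.id)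
      (fun T hT => forceOp_splitOp (mem_edges hT)) ht
  have hi : i + 1 - 1 - 1 = i - 1 := by ring
  have hj : j - 1 + 1 = j := by ring
  rw [hi, hj] at hy
  have hdy := partialDifferential_forceOp hs hF hab hn hy
  rw [hyt, hdt] at hdy
  have hd0 : addOp ends v e (splitOp ends v e t) = 0 :=
    (eqOn_supported (g := 0) (fun S hS => addOp_single_of_annihilates _ _ hS.2) hy :)
  -- The minus sign compensates the anticommutation of `forceOp` with the differential.
  refine ⟨-splitOp ends v e t, neg_mem (intervalCochains_le_insert
    (Finsupp.supported_mono (Set.sep_subset _ _) hy)), ?_⟩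
  rw [map_neg, partialDifferential_insert hF, hd0, zero_add, ← hinv hz, hdy, map_neg,
    hinv (partialDifferential_mem_annihilatedStates hab hn hy)]

/-- This is the middle exactness of the long exact sequence: find a primitive of the deletion part,
then one of the corrected contraction part. -/
theorem exactAt_of_deletion_contraction (hs : e ∉ s) (hF : e ∉ F)
    (h : ExactAt ends v s F i j) (h' : ExactAt ends v (insert e s) F i j) :
    ExactAt ends v s (insert e F) i j := by
  intro z hz hdz
  rw [intervalCochains, stateInterval_insert, Finsupp.supported_union, Submodule.mem_sup] at hz
  obtain ⟨x, hx, y, hy, rfl⟩ := hz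
  obtain ⟨h1, h2⟩ := cocycle_components hs hF hx hy hdz
  obtain ⟨x', hx', rfl⟩ := h x hx h1
  have hmem : y - addOp ends v e x' ∈ intervalCochains ends v (insert e s) F i j := by
    have := addOp_mem hs hF hx'
    rw [sub_add_cancel] at this
    exact sub_mem hy this
  have hd : partialDifferential ends v F (y - addOp ends v e x') = 0 := by
    have h3 := partialDifferential_partialDifferential (insert e F) x'
    rw [partialDifferential_insert hF x', map_add, partialDifferential_insert hF,
      partialDifferential_insert hF, partialDifferential_partialDifferential, add_zero,
      addOp_eq_zero (addOp_mem hs hF hx'), zero_add] at h3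
    rw [map_sub, eq_neg_of_add_eq_zero_left h3, sub_neg_eq_add, add_comm]
    exact h2
  obtain ⟨y', hy', hdy'⟩ := h' _ hmem hd
  refine ⟨x' + y', add_mem (intervalCochains_le_insert hx')
    (intervalCochains_insert_le_insert hy'), ?_⟩
  rw [map_add, partialDifferential_insert hF, partialDifferential_insert hF, addOp_eq_zero hy',
    hdy']
  abel

/-- The number of components of `s` plus `s.card` is unchanged by contracting a non-loop edge, so
all recursive calls stay off the same diagonal. -/
theorem exactAt_of_preconnected (n : ℕ) : ∀ (s F : Finset E) (i j : ℤ), F.card = n →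
    Disjoint s F → (stateGraph ends (s ∪ F)).Preconnected →
    i + j ≠ Nat.card (stateGraph ends s).ConnectedComponent + s.card - 1 →
    ExactAt ends v s F i j := by
  induction n with
  | zero =>
    intro s F i j hF _ hc hij z hz _
    obtain rfl := Finset.card_eq_zero.1 hF
    rw [Finset.union_empty] at hc
    rw [intervalCochains, stateInterval_empty hc hij, Finsupp.supported_empty,
      Submodule.mem_bot] at hz
    exact ⟨0, zero_mem _, by rw [hz, map_zero]⟩
  | succ n ih =>
    intro s F i j hcard hdisj hc hij
    obtain ⟨e, he, a, b, hab, hva⟩ := exists_edge_at_base hc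
      (Finset.card_pos.1 (by omega)) v
    obtain ⟨F, hF, rfl⟩ : ∃ F', e ∉ F' ∧ F = insert e F' :=
      ⟨F.erase e, Finset.notMem_erase _ _, (Finset.insert_erase he).symm⟩
    rw [Finset.card_insert_of_notMem hF, Nat.add_right_cancel_iff] at hcard
    rw [Finset.disjoint_insert_right] at hdisj
    obtain ⟨hs, hdisj⟩ := hdisj
    by_cases hloop : (stateGraph ends s).Reachable a b
    · exact exactAt_of_loop hs hF hab hva hloop
    have hk := card_component_insert hab hloop
    have hks := Finset.card_insert_of_notMem hs
    have hcontr : ∀ i j : ℤ,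
        i + j ≠ Nat.card (stateGraph ends s).ConnectedComponent + s.card - 1 →
        ExactAt ends v (insert e s) F i j := fun i j hij =>
      ih _ _ _ _ hcard (Finset.disjoint_insert_left.2 ⟨hF, hdisj⟩)
        (by rwa [Finset.insert_union, ← Finset.union_insert]) (by omega)
    by_cases hbridge : (stateGraph ends (s ∪ F)).Reachable a b
    · refine exactAt_of_deletion_contraction hs hF (ih _ _ _ _ hcard hdisj ?_ hij) (hcontr _ _ hij)
      intro x y
      have hxy := hc x y
      rw [Finset.union_insert] at hxy
      rcases (reachable_insert_iff hab).1 hxy with h | ⟨h1, h2⟩ | ⟨h1, h2⟩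
      · exact h
      · exact h1.trans (hbridge.trans h2)
      · exact h1.trans (hbridge.symm.trans h2)
    -- The shift to `(i + 1, j - 1)` preserves `i + j`.
    · exact exactAt_of_bridge hs hF hab hva hbridge (hcontr _ _ (by omega))

end Vanishing

/-! ### Dimension counts and independence of the base vertex -/

section Dimension

variable {V E : Type*} {ends : E → Sym2 V}

namespace EnhancedState

open Classical in
/-- Move the base vertex by exchanging the colors of the components of the two base vertices. -/
noncomputable def rebase {v : V} (v' : V) (S : EnhancedState ends v) : EnhancedState ends v' where
  edges := S.edges
  color K := S.color (Equiv.swap (S.comp v) (S.comp v') K)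
  base_color := by
    change S.color (Equiv.swap (S.comp v) (S.comp v') (S.comp v')) = Color.x
    rw [Equiv.swap_apply_right]
    exact S.base_color

theorem rebase_rebase {v : V} (v' : V) (S : EnhancedState ends v) :
    (S.rebase v').rebase v = S := by
  classical
  obtain ⟨s, c, h⟩ := S
  change (⟨s, fun K => c (Equiv.swap ((stateGraph ends s).connectedComponentMk v)
    ((stateGraph ends s).connectedComponentMk v')
    (Equiv.swap ((stateGraph ends s).connectedComponentMk v')
      ((stateGraph ends s).connectedComponentMk v) K)), _⟩ : EnhancedState ends v) = ⟨s, c, h⟩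
  congr
  funext K
  rw [Equiv.swap_comm, Equiv.swap_apply_self]

theorem degree_rebase {v : V} (v' : V) (S : EnhancedState ends v) :
    (S.rebase v').degree = S.degree := by
  classical
  change ((Equiv.swap (S.comp v) (S.comp v') ⁻¹' {K | S.color K = Color.x}).ncard : ℤ) - 1 = _
  rw [Set.ncard_preimage_of_injective_subset_range (Equiv.injective _) (by simp), degree]

/-- The bijection between the states for two base vertices given by `rebase`. -/
noncomputable def rebaseEquiv (ends : E → Sym2 V) (v v' : V) :
    EnhancedState ends v ≃ EnhancedState ends v' where
  toFun := rebase v'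
  invFun := rebase v
  left_inv := rebase_rebase v'
  right_inv := rebase_rebase v

/-- Finiteness makes all spaces finite-dimensional, so equal `finrank` yields an isomorphism. -/
instance [Finite V] [Finite E] (v : V) : Finite (EnhancedState ends v) :=
  Finite.of_injective (fun S : EnhancedState ends v => (S.edges, fun u => S.colorAt u = Color.x))
    fun _ _ h => ext_colorAt (Prod.ext_iff.1 h).1
      fun u => (congrFun (Prod.ext_iff.1 h).2 u).to_iff

end EnhancedState

theorem finrank_cochains (v v' : V) (i j : ℤ) :
    Module.finrank ℝ (cochains ends v i j) = Module.finrank ℝ (cochains ends v' i j) := by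
  refine LinearEquiv.finrank_eq ((Finsupp.supportedEquivFinsupp _).trans
    ((Finsupp.domLCongr (Equiv.subtypeEquiv (EnhancedState.rebaseEquiv ends v v')
      fun S => ?_)).trans (Finsupp.supportedEquivFinsupp _).symm))
  change _ ↔ (S.rebase v').dimension = i ∧ (S.rebase v').degree = j
  rw [S.degree_rebase]
  rfl

variable [Fintype E]

theorem cochains_eq_bot (v : V) {i : ℤ} (j : ℤ) (hi : i < 0 ∨ (Fintype.card E : ℤ) < i) :
    cochains ends v i j = ⊥ := by
  rw [cochains, ← Finsupp.supported_empty]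
  congr 1
  refine Set.eq_empty_of_forall_notMem ?_
  rintro S ⟨rfl, -⟩
  have := S.edges.card_le_univ
  rw [EnhancedState.dimension] at hi
  omega

variable [LinearOrder E]

theorem cochains_eq_intervalCochains (v : V) (i j : ℤ) :
    cochains ends v i j = intervalCochains ends v ∅ Finset.univ i j := by
  simp [cochains, intervalCochains, stateInterval]

variable [Finite V]

theorem coboundaries_le_cocycles (v : V) (i j : ℤ) :
    coboundaries ends v i j ≤ cocycles ends v i j := by
  rw [coboundaries, Submodule.map_le_iff_le_comap]
  intro z hz
  rw [cochains_eq_intervalCochains] at hz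
  have h := partialDifferential_mem hz
  rw [sub_add_cancel, ← cochains_eq_intervalCochains] at h
  rw [Submodule.mem_comap, differential_eq]
  refine ⟨h, ?_⟩
  rw [SetLike.mem_coe, LinearMap.mem_ker, differential_eq]
  exact partialDifferential_partialDifferential _ z

/-- This is the case `s = ∅`, `F = univ` of `exactAt_of_preconnected`. -/
theorem cocycles_eq_coboundaries (hc : (stateGraph ends Finset.univ).Preconnected) (v : V)
    {i j : ℤ} (hij : i + j ≠ Nat.card (stateGraph ends ∅).ConnectedComponent - 1) :
    cocycles ends v i j = coboundaries ends v i j := by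
  refine le_antisymm ?_ (coboundaries_le_cocycles v i j)
  rintro z ⟨hz, hdz⟩
  rw [SetLike.mem_coe, LinearMap.mem_ker, differential_eq] at hdz
  rw [SetLike.mem_coe, cochains_eq_intervalCochains] at hz
  obtain ⟨y, hy, hyz⟩ := exactAt_of_preconnected _ ∅ Finset.univ i j rfl
    (Finset.disjoint_empty_left _) (by rwa [Finset.empty_union]) (by simpa using hij) z hz hdz
  refine ⟨y, ?_, by rw [differential_eq, hyz]⟩
  rw [cochains_eq_intervalCochains]
  exact hy

theorem finrank_cocycles_add_finrank_coboundaries (v : V) (i j : ℤ) :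
    Module.finrank ℝ (cocycles ends v i j) + Module.finrank ℝ (coboundaries ends v (i + 1) j) =
      Module.finrank ℝ (cochains ends v i j) := by
  have h := LinearMap.finrank_range_add_finrank_ker
    ((differential ends v).domRestrict (cochains ends v i j))
  rw [LinearMap.range_domRestrict, LinearMap.ker_domRestrict,
    ← Submodule.finrank_map_subtype_eq, Submodule.map_comap_subtype] at h
  rw [← h, add_comm, coboundaries, add_sub_cancel_right, cocycles]

theorem finrank_reducedCohomology (v : V) (i j : ℤ) :
    Module.finrank ℝ (reducedCohomology ends v i j) + Module.finrank ℝ (coboundaries ends v i j) =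
      Module.finrank ℝ (cocycles ends v i j) := by
  rw [← (Submodule.submoduleOfEquivOfLe (coboundaries_le_cocycles v i j)).finrank_eq]
  exact Submodule.finrank_quotient_add_finrank _

end Dimension

/-- The dimensions of a bounded complex that is exact away from degree `m` determine the dimensions
of cycles and boundaries in degree `m`. -/
theorem eq_of_exact_away {c z z' b b' : ℤ → ℕ} {m : ℤ} {N : ℕ}
    (h : ∀ i, z i + b (i + 1) = c i) (h' : ∀ i, z' i + b' (i + 1) = c i)
    (hm : ∀ i, i ≠ m → z i = b i) (hm' : ∀ i, i ≠ m → z' i = b' i)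
    (hc : ∀ i, i < 0 ∨ (N : ℤ) < i → c i = 0) : z m = z' m ∧ b m = b' m := by
  -- Cycles are determined by descending from above `N`, where the complex vanishes.
  have hz : ∀ n : ℕ, ∀ i : ℤ, (N : ℤ) < i + n → m ≤ i → z i = z' i := by
    intro n
    induction n with
    | zero =>
      intro i hi _
      have := h i
      have := h' i
      have := hc i (Or.inr (by omega))
      omega
    | succ n ih =>
      intro i hi hmi
      have := ih (i + 1) (by push_cast at hi; omega) (by omega)
      have := h i
      have := h' i
      have := hm (i + 1) (by omega)
      have := hm' (i + 1) (by omega)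
      omega
  -- Boundaries are determined by ascending from nonpositive degrees, whose incoming cochains
  -- vanish.
  have hb : ∀ n : ℕ, ∀ i : ℤ, i ≤ n → i ≤ m → b i = b' i := by
    intro n
    induction n with
    | zero =>
      intro i hi _
      have h1 := h (i - 1)
      have h2 := h' (i - 1)
      have := hc (i - 1) (Or.inl (by push_cast at hi; omega))
      rw [sub_add_cancel] at h1 h2
      omega
    | succ n ih =>
      intro i hi hmi
      have h1 := h (i - 1)
      have h2 := h' (i - 1)
      rw [sub_add_cancel] at h1 h2
      have := ih (i - 1) (by push_cast at hi; omega) (by omega)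
      have := hm (i - 1) (by omega)
      have := hm' (i - 1) (by omega)
      omega
  -- The term `(-m).toNat` covers negative `m`.
  exact ⟨hz (N + 1 + (-m).toNat) m (by push_cast; omega) le_rfl, hb m.toNat m (by omega) le_rfl⟩

theorem finrank_reducedCohomology_eq {V E : Type*} [Finite V] [Fintype E] [LinearOrder E]
    {ends : E → Sym2 V} (hc : (stateGraph ends Finset.univ).Preconnected) (v v' : V) (i j : ℤ) :
    Module.finrank ℝ (reducedCohomology ends v i j) =
      Module.finrank ℝ (reducedCohomology ends v' i j) := by
  have h := finrank_reducedCohomology (ends := ends) v i j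
  have h' := finrank_reducedCohomology (ends := ends) v' i j
  have hexact : ∀ (w : V) (k : ℤ),
      k + j ≠ Nat.card (stateGraph ends ∅).ConnectedComponent - 1 →
      Module.finrank ℝ (cocycles ends w k j) = Module.finrank ℝ (coboundaries ends w k j) :=
    fun w k hk => congrArg (fun p : Submodule ℝ (EnhancedState ends w →₀ ℝ) =>
      Module.finrank ℝ p) (cocycles_eq_coboundaries hc w hk)
  by_cases hij : i + j = Nat.card (stateGraph ends ∅).ConnectedComponent - 1
  · have hne : ∀ k, k ≠ i → k + j ≠ Nat.card (stateGraph ends ∅).ConnectedComponent - 1 :=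
      fun k hk hkj => hk (by omega)
    have := eq_of_exact_away (m := i) (N := Fintype.card E)
      (c := fun i => Module.finrank ℝ (cochains ends v i j))
      (z := fun i => Module.finrank ℝ (cocycles ends v i j))
      (z' := fun i => Module.finrank ℝ (cocycles ends v' i j))
      (b := fun i => Module.finrank ℝ (coboundaries ends v i j))
      (b' := fun i => Module.finrank ℝ (coboundaries ends v' i j))
      (fun k => finrank_cocycles_add_finrank_coboundaries v k j)
      (fun k => (finrank_cocycles_add_finrank_coboundaries v' k j).trans (finrank_cochains _ _ _ _))
      (fun k hk => hexact v k (hne k hk))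
      (fun k hk => hexact v' k (hne k hk))
      (fun k hk => by rw [cochains_eq_bot v j hk, finrank_bot])
    omega
  · have := hexact v i hij
    have := hexact v' i hij
    omega

end ChromaticCohomology

theorem mainTheorem5 {V : Type*} [Finite V] (G : SimpleGraph V) (hG : G.Connected)
    [Fintype G.edgeSet] [LinearOrder G.edgeSet] (v v' : V) (i j : ℤ) :
    Nonempty (G.reducedCohomology v i j ≃ₗ[ℝ] G.reducedCohomology v' i j) := by
  refine ⟨LinearEquiv.ofFinrankEq _ _ (ChromaticCohomology.finrank_reducedCohomology_eq ?_ v v' i j)⟩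
  have h : ChromaticCohomology.stateGraph (fun e : G.edgeSet => (e : Sym2 V)) Finset.univ = G := by
    rw [ChromaticCohomology.stateGraph, Finset.coe_univ, Set.image_univ, Subtype.range_coe_subtype,
      Set.ofPred_mem_eq, SimpleGraph.fromEdgeSet_edgeSet]
  rw [h]
  exact hG.preconnected
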